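/- Manifolds are smooth, and a Riemannian manifold with boundary carries its intrinsic (length) distance, equal to $+\infty$ between points of different connected components; it is called complete if it is complete as a metric space. Let $m\ge 1$, let $(M,g_M)$ be an $m$-dimensional Riemannian manifold with boundary $\partial M$, let $Q$ be an $m$-dimensional manifold with boundary, and let $\eta:\partial M\to\partial Q$ be a diffeomorphism. Let $N=M\cup_\eta Q$ be the smooth gluing of $M$ and $Q$ along $\eta$, i.e. the topological space obtained from $M\sqcup Q$ by identifying $x$ with $\eta(x)$ for all $x\in\partial M$, with a structure of smooth manifold without boundary for which the inclusions of $M$ and $Q$ are smooth embeddings; regard $M$ and $Q$ as subsets of $N$, with $M\cap Q=\partial M$. Let $\tilde g$ be a Riemannian metric on $N$ with $\tilde g=g_M$ on $M$, and let $\varepsilon>0$. Let $\mathcal X_Q\subseteq Q$ be a tubular neighborhood of $\partial M$ in $Q$, that is, a neighborhood of $\partial M=\partial Q$ in $Q$ for which there is a diffeomorphism $\partial M\times[0,1]\to\mathcal X_Q$ sending $(x,0)$ to $x$, such that: (a) $P:=M\cup\mathcal X_Q\subset N$ is a manifold with smooth boundary (smoothly embedded in $N$); let $g_P:=\tilde g|_P$;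 (b) there is a map $\rho:P\to M$ with $\rho(x)=x$ for all $x\in M$, which is $(1+\varepsilon)$-Lipschitz with respect to the intrinsic distances of $(P,g_P)$ and $(M,g_M)$, and which restricts to a diffeomorphism of $\mathcal X_Q$ onto a tubular neighborhood $\mathcal X_M$ of $\partial M$ in $M$ (in the same sense as above) that is a closed subset of $M$. If $(M,g_M)$ is complete, then $(P,g_P)$ is complete. -/

import Mathlib

open scoped Manifold ContDiff NNReal Topology Bundle

section CollarExtension

/-- `f` restricts to a smooth diffeomorphism of the subset `S` onto the subset `T`. -/
def IsDiffeoOn {E E' : Type*} [NormedAddCommGroup E] [NormedSpace ℝ E]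
    [NormedAddCommGroup E'] [NormedSpace ℝ E'] {H H' : Type*} [TopologicalSpace H]
    [TopologicalSpace H'] (I : ModelWithCorners ℝ E H) (I' : ModelWithCorners ℝ E' H')
    {X Y : Type*} [TopologicalSpace X] [ChartedSpace H X] [TopologicalSpace Y] [ChartedSpace H' Y]
    (f : X → Y) (S : Set X) (T : Set Y) : Prop :=
  Set.BijOn f S T ∧ ContMDiffOn I I' ∞ f S ∧
    ∃ g : Y → X, ContMDiffOn I' I ∞ g T ∧ Set.InvOn g f S T

/-- `b : B → X` realizes the smooth manifold `B` (without boundary, of dimension `k`) as the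
boundary of the manifold with boundary `X` (of dimension `k + 1`). -/
structure IsBoundaryParam (k : ℕ) {B X : Type*}
    [TopologicalSpace B] [ChartedSpace (EuclideanSpace ℝ (Fin k)) B]
    [TopologicalSpace X] [ChartedSpace (EuclideanHalfSpace (k + 1)) X] (b : B → X) : Prop where
  isSmoothEmbedding : Manifold.IsSmoothEmbedding (𝓡 k) (𝓡∂ (k + 1)) ∞ b
  range_eq : Set.range b = (𝓡∂ (k + 1)).boundary X

/-- `N` is the smooth gluing of the manifolds with boundary `M` and `Q` along their boundaries:
as a topological space it is the quotient of `M ⊕ Q` obtained by identifying `bM z ∈ ∂M` with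
`bQ z ∈ ∂Q` for every `z ∈ B` (so the gluing diffeomorphism `∂M → ∂Q` is `bQ ∘ bM⁻¹`), and the
inclusions `iM` and `iQ` are smooth embeddings. -/
structure IsSmoothGluing (k : ℕ) {B M Q N : Type*}
    [TopologicalSpace B] [ChartedSpace (EuclideanSpace ℝ (Fin k)) B]
    [TopologicalSpace M] [ChartedSpace (EuclideanHalfSpace (k + 1)) M]
    [TopologicalSpace Q] [ChartedSpace (EuclideanHalfSpace (k + 1)) Q]
    [TopologicalSpace N] [ChartedSpace (EuclideanSpace ℝ (Fin (k + 1))) N]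
    (bM : B → M) (bQ : B → Q) (iM : M → N) (iQ : Q → N) : Prop where
  boundary_left : IsBoundaryParam k bM
  boundary_right : IsBoundaryParam k bQ
  isSmoothEmbedding_left : Manifold.IsSmoothEmbedding (𝓡∂ (k + 1)) (𝓡 (k + 1)) ∞ iM
  isSmoothEmbedding_right : Manifold.IsSmoothEmbedding (𝓡∂ (k + 1)) (𝓡 (k + 1)) ∞ iQ
  isQuotientMap : Topology.IsQuotientMap (Sum.elim iM iQ)
  eq_iff : ∀ (x : M) (y : Q), iM x = iQ y ↔ ∃ z : B, bM z = x ∧ bQ z = y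

/-- `S` is a tubular neighborhood (including its outer boundary) of the boundary of `X`: it is a
neighborhood of `∂X` and is diffeomorphic to `∂X × [0, 1]`, with `∂X × {0}` mapped
identically to `∂X`. -/
structure IsTubularNhd (k : ℕ) {B X : Type*}
    [TopologicalSpace B] [ChartedSpace (EuclideanSpace ℝ (Fin k)) B]
    [TopologicalSpace X] [ChartedSpace (EuclideanHalfSpace (k + 1)) X]
    (b : B → X) (S : Set X) : Prop where
  mem_nhdsSet : S ∈ 𝓝ˢ ((𝓡∂ (k + 1)).boundary X)
  exists_collar : ∃ c : B × ℝ → X,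
    IsDiffeoOn ((𝓡 k).prod 𝓘(ℝ, ℝ)) (𝓡∂ (k + 1)) c (Set.univ ×ˢ Set.Icc (0 : ℝ) 1) S ∧
      ∀ z : B, c (z, 0) = b z

/-- `f : X → Y` is a smooth embedding such that the Riemannian metric of `X` is the pullback of
the one of `Y` (the restriction of the metric of `Y`, if `X` is seen as a subset of `Y`). -/
structure IsRiemannianEmbedding {E E' : Type*} [NormedAddCommGroup E] [NormedSpace ℝ E]
    [NormedAddCommGroup E'] [NormedSpace ℝ E'] {H H' : Type*} [TopologicalSpace H]
    [TopologicalSpace H'] (I : ModelWithCorners ℝ E H) (I' : ModelWithCorners ℝ E' H')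
    {X Y : Type*} [TopologicalSpace X] [ChartedSpace H X] [TopologicalSpace Y] [ChartedSpace H' Y]
    [Bundle.RiemannianBundle (fun x : X ↦ TangentSpace I x)]
    [Bundle.RiemannianBundle (fun y : Y ↦ TangentSpace I' y)] (f : X → Y) : Prop where
  isSmoothEmbedding : Manifold.IsSmoothEmbedding I I' ∞ f
  inner_mfderiv : ∀ (x : X) (v w : TangentSpace I x),
    inner ℝ (mfderiv I I' f x v) (mfderiv I I' f x w) = inner ℝ v w

end CollarExtension

/-! A Cauchy filter on `P` is pushed by the Lipschitz map `ρ` to a Cauchy filter on `M`, which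
converges. To lift the limit back, split `P` into `M` and the collar: the filter meets at least one
of them, and on each `ρ` has a continuous inverse defined on a closed set (all of `M`, respectively
`XM`). The lift is a cluster point, and a Cauchy filter converges to its cluster points. The metrics
enter only through the uniform continuity of `ρ`. -/

open Filter in
/-- A Cauchy filter that meets a set `S` on which a uniformly continuous map to a complete space
has closed image and a continuous left inverse converges. -/
theorem Cauchy.exists_le_nhds_of_leftInvOn {X Y : Type*} [UniformSpace X] [UniformSpace Y]
    [CompleteSpace Y] {f : X → Y} (hf : UniformContinuous f) {S : Set X} {T : Set Y} {g : Y → X}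
    (hST : Set.MapsTo f S T) (hT : IsClosed T) (hg : ContinuousOn g T) (hgf : Set.LeftInvOn g f S)
    {F : Filter X} (hF : Cauchy F) [hS : NeBot (F ⊓ 𝓟 S)] : ∃ x, F ≤ 𝓝 x := by
  obtain ⟨y, hy⟩ := CompleteSpace.complete (hF.map hf)
  have hfy : Tendsto f (F ⊓ 𝓟 S) (𝓝 y) := (tendsto_map'_iff.2 hy).mono_left inf_le_left
  have hfT : ∀ᶠ x in F ⊓ 𝓟 S, f x ∈ T := mem_inf_of_right fun x hx ↦ hST hx
  -- Closedness keeps the limit where `g` is continuous.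
  have hyT : y ∈ T := hT.mem_of_tendsto hfy hfT
  have hgfy : Tendsto (g ∘ f) (F ⊓ 𝓟 S) (𝓝 (g y)) :=
    (hg y hyT).tendsto.comp (tendsto_nhdsWithin_iff.2 ⟨hfy, hfT⟩)
  have hid : Tendsto id (F ⊓ 𝓟 S) (𝓝 (g y)) :=
    hgfy.congr' (mem_inf_of_right fun x hx ↦ hgf hx)
  exact ⟨g y, le_nhds_of_cauchy_adhp hF (NeBot.mono hS (le_inf hid inf_le_left))⟩

open Filter in
/-- A uniform space is complete if it is the union of two sets on each of which a uniformly
continuous map to a complete space has closed image and a continuous left inverse. -/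
theorem completeSpace_of_union_leftInvOn {X Y : Type*} [UniformSpace X] [UniformSpace Y]
    [CompleteSpace Y] {f : X → Y} (hf : UniformContinuous f) {S₁ S₂ : Set X} {T₁ T₂ : Set Y}
    {g₁ g₂ : Y → X} (hS : S₁ ∪ S₂ = Set.univ)
    (hST₁ : Set.MapsTo f S₁ T₁) (hT₁ : IsClosed T₁) (hg₁ : ContinuousOn g₁ T₁)
    (hgf₁ : Set.LeftInvOn g₁ f S₁)
    (hST₂ : Set.MapsTo f S₂ T₂) (hT₂ : IsClosed T₂) (hg₂ : ContinuousOn g₂ T₂)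
    (hgf₂ : Set.LeftInvOn g₂ f S₂) : CompleteSpace X where
  complete {F} hF := by
    -- The join is `F` itself, so one of the two traces is proper.
    have hne : NeBot (F ⊓ 𝓟 S₁ ⊔ F ⊓ 𝓟 S₂) := by
      rw [← inf_sup_left, sup_principal, hS, principal_univ, inf_top_eq]
      exact hF.1
    rcases sup_neBot.1 hne with h | h
    · exact hF.exists_le_nhds_of_leftInvOn hf hST₁ hT₁ hg₁ hgf₁
    · exact hF.exists_le_nhds_of_leftInvOn hf hST₂ hT₂ hg₂ hgf₂

theorem mainTheorem5 (k : ℕ) {B M Q N P : Type*}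
    -- the common boundary of `M` and `Q`
    [TopologicalSpace B] [ChartedSpace (EuclideanSpace ℝ (Fin k)) B] [IsManifold (𝓡 k) ∞ B]
    -- the Riemannian manifold with boundary `(M, g_M)`, with its intrinsic distance
    [EMetricSpace M] [ChartedSpace (EuclideanHalfSpace (k + 1)) M] [IsManifold (𝓡∂ (k + 1)) ∞ M]
    [Bundle.RiemannianBundle (fun x : M ↦ TangentSpace (𝓡∂ (k + 1)) x)]
    [IsContMDiffRiemannianBundle (𝓡∂ (k + 1)) ∞ (EuclideanSpace ℝ (Fin (k + 1)))
      (fun x : M ↦ TangentSpace (𝓡∂ (k + 1)) x)]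
    [IsRiemannianManifold (𝓡∂ (k + 1)) M]
    -- the manifold with boundary `Q`
    [TopologicalSpace Q] [ChartedSpace (EuclideanHalfSpace (k + 1)) Q]
    [IsManifold (𝓡∂ (k + 1)) ∞ Q]
    -- the Riemannian manifold without boundary `(N, g̃)`
    [TopologicalSpace N] [T2Space N] [SecondCountableTopology N]
    [ChartedSpace (EuclideanSpace ℝ (Fin (k + 1))) N] [IsManifold (𝓡 (k + 1)) ∞ N]
    [Bundle.RiemannianBundle (fun x : N ↦ TangentSpace (𝓡 (k + 1)) x)]
    [IsContMDiffRiemannianBundle (𝓡 (k + 1)) ∞ (EuclideanSpace ℝ (Fin (k + 1)))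
      (fun x : N ↦ TangentSpace (𝓡 (k + 1)) x)]
    -- the Riemannian manifold with boundary `(P, g_P)`, with its intrinsic distance
    [EMetricSpace P] [ChartedSpace (EuclideanHalfSpace (k + 1)) P] [IsManifold (𝓡∂ (k + 1)) ∞ P]
    [Bundle.RiemannianBundle (fun x : P ↦ TangentSpace (𝓡∂ (k + 1)) x)]
    [IsContMDiffRiemannianBundle (𝓡∂ (k + 1)) ∞ (EuclideanSpace ℝ (Fin (k + 1)))
      (fun x : P ↦ TangentSpace (𝓡∂ (k + 1)) x)]
    [IsRiemannianManifold (𝓡∂ (k + 1)) P]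
    -- `N` is the gluing of `M` and `Q`, and `g̃ = g_M` on `M`
    (bM : B → M) (bQ : B → Q) (iM : M → N) (iQ : Q → N)
    (hN : IsSmoothGluing k bM bQ iM iQ)
    (hM : IsRiemannianEmbedding (𝓡∂ (k + 1)) (𝓡 (k + 1)) iM)
    -- `P = M ∪ XQ` for a tubular neighborhood `XQ`, and `g_P` is the restriction of `g̃`
    (XQ : Set Q) (hXQ : IsTubularNhd k bQ XQ)
    (j : P → N) (hj : IsRiemannianEmbedding (𝓡∂ (k + 1)) (𝓡 (k + 1)) j)
    (hP : Set.range j = Set.range iM ∪ iQ '' XQ)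
    -- the `(1 + ε)`-Lipschitz projection `ρ : P → M`, which maps `XQ` diffeomorphically onto a
    -- tubular neighborhood `XM` of the boundary of `M` that is a closed subset of `M`
    (ε : ℝ≥0) (hε : 0 < ε) (ρ : P → M) (hρ : LipschitzWith (1 + ε) ρ)
    (hρM : ∀ (p : P) (x : M), j p = iM x → ρ p = x)
    (XM : Set M) (hXM : IsTubularNhd k bM XM) (hXM_closed : IsClosed XM)
    (hρX : IsDiffeoOn (𝓡∂ (k + 1)) (𝓡∂ (k + 1)) ρ (j ⁻¹' (iQ '' XQ)) XM)
    (hcomplete : CompleteSpace M) :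
    CompleteSpace P := by
  have hjemb : Topology.IsEmbedding j := hj.isSmoothEmbedding.isEmbedding
  -- `s` is the inclusion of `M` into `P`; it inverts `ρ` on the part of `P` lying in `M`, since `ρ`
  -- fixes `M`.
  have hs : ∀ x : M, ∃ p : P, j p = iM x := fun x ↦
    hP.superset (Set.mem_union_left _ (Set.mem_range_self x))
  choose s hs using hs
  have hs_cont : Continuous s := by
    -- `P` carries the topology induced by `j`, and `j ∘ s = iM`.
    rw [hjemb.continuous_iff, funext hs (f := j ∘ s)]
    exact hM.isSmoothEmbedding.isEmbedding.continuous
  obtain ⟨hbij, -, g, hg, hinv⟩ := hρX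
  refine completeSpace_of_union_leftInvOn hρ.uniformContinuous
    (S₁ := j ⁻¹' Set.range iM) (S₂ := j ⁻¹' (iQ '' XQ)) ?_
    (Set.mapsTo_univ _ _) isClosed_univ hs_cont.continuousOn ?_
    hbij.mapsTo hXM_closed hg.continuousOn hinv.1
  · rw [← Set.preimage_union, ← hP, Set.preimage_range]
  · rintro p ⟨x, hx⟩
    exact hjemb.injective (by rw [hρM p x hx.symm, hs, hx])
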